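/- All rings are commutative with identity and all modules are unitary. For a ring $R$, let $R\ltimes R$ be its trivial extension by itself: the additive group $R\times R$ with multiplication $(r,m)(r',m')=(rr',\,rm'+r'm)$. Suprema below run over all $R$-modules $M$, and infima of empty sets are $\infty$. - $\mathrm{gldim}(R)=\sup_M \mathrm{pd}_R(M)$, and $\mathrm{FPD}(R)=\sup\{\mathrm{pd}_R(M) : \mathrm{pd}_R(M)<\infty\}$, where $\mathrm{pd}_R$ denotes projective dimension. - $\mathrm{cot.D}(R)=\sup_M \mathrm{cd}_R(M)$, where the cotorsion dimension $\mathrm{cd}_R(M)$ is the least integer $n\ge 0$ such that $\mathrm{Ext}_R^{n+1}(F,M)=0$ for all flat $R$-modules $F$. - An $R$-module is Gorenstein projective if it is isomorphic to the image of a differential of an exact complex of projective $R$-modules, indexed by $\mathbb Z$, that remains exact under $\mathrm{Hom}_R(-,Q)$ for every projective $R$-module $Q$. The Gorenstein projective dimension $\mathrm{Gpd}_R(M)$ is the least integer $n\ge 0$ for which there is an exact sequence $0\to G_n\to\cdots\to G_0\to M\to 0$ with all $G_i$ Gorenstein projective, and $\mathrm{G\text{-}gldim}(R)=\sup_M \mathrm{Gpd}_R(M)$.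 - $R$ is coherent if every finitely generated ideal of $R$ is finitely presented. **Proposition 2.6.** Let $R$ be a commutative ring. Then $$\mathrm{FPD}(R\ltimes R)=\mathrm{FPD}(R),\qquad \mathrm{cot.D}(R\ltimes R)=\mathrm{cot.D}(R),$$ and, if $R\neq 0$, $\mathrm{gldim}(R\ltimes R)=\infty$. If moreover $R$ is coherent, then $$\mathrm{G\text{-}gldim}(R\ltimes R)=\mathrm{G\text{-}gldim}(R).$$ -/

import Mathlib

open CategoryTheory

universe u

namespace HomDim

noncomputable section

/-- A commutative ring is coherent if each of its finitely generated ideals is finitely presented. -/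
def IsCoherentRing (R : Type u) [CommRing R] : Prop :=
  ∀ I : Ideal R, I.FG → Module.FinitePresentation R I

/-- The global dimension: the supremum of the projective dimensions of all `R`-modules. -/
def gldim (R : Type u) [CommRing R] : WithBot ℕ∞ :=
  ⨆ M : ModuleCat.{u} R, projectiveDimension M

/-- The finitistic projective dimension: the supremum of the projective dimensions of all
`R`-modules of finite projective dimension. -/
def FPD (R : Type u) [CommRing R] : WithBot ℕ∞ :=
  ⨆ (M : ModuleCat.{u} R) (_ : projectiveDimension M < ⊤), projectiveDimension M

/-- The cotorsion dimension of `M`: the least `n : ℕ` such that `Ext^{n+1}(F, M) = 0` for all flat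
modules `F`, and `⊤` if there is no such `n`. -/
def cotorsionDim {R : Type u} [CommRing R] (M : ModuleCat.{u} R) : ℕ∞ :=
  ⨅ (n : ℕ) (_ : ∀ F : ModuleCat.{u} R, Module.Flat R F →
    Subsingleton (Abelian.Ext.{u} F M (n + 1))), (n : ℕ∞)

/-- The global cotorsion dimension: the supremum of the cotorsion dimensions of all `R`-modules. -/
def cotD (R : Type u) [CommRing R] : ℕ∞ :=
  ⨆ M : ModuleCat.{u} R, cotorsionDim M

/-- `⋯ → P i → P (i + 1) → ⋯` is a complete projective resolution: an exact sequence of projective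
modules that stays exact under `Hom(-, Q)` for every projective module `Q`. -/
structure IsCompleteProjRes {R : Type u} [CommRing R] (P : ℤ → ModuleCat.{u} R)
    (d : ∀ i : ℤ, P i →ₗ[R] P (i + 1)) : Prop where
  projective : ∀ i, Module.Projective R (P i)
  exact : ∀ i, Function.Exact (d i) (d (i + 1))
  hom_exact : ∀ Q : ModuleCat.{u} R, Module.Projective R Q → ∀ i,
    Function.Exact (fun f : P (i + 1 + 1) →ₗ[R] Q => f ∘ₗ d (i + 1))
      (fun f : P (i + 1) →ₗ[R] Q => f ∘ₗ d i)

/-- A module is Gorenstein projective if it is isomorphic to the image of a differential of a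
complete projective resolution. -/
def IsGorensteinProjective {R : Type u} [CommRing R] (M : ModuleCat.{u} R) : Prop :=
  ∃ (P : ℤ → ModuleCat.{u} R) (d : ∀ i : ℤ, P i →ₗ[R] P (i + 1)),
    IsCompleteProjRes P d ∧ Nonempty (M ≃ₗ[R] LinearMap.range (d 0))

/-- `HasGprojRes n M` : there is an exact sequence `0 → G_n → ⋯ → G_1 → G_0 → M → 0` in which all
`G_i` are Gorenstein projective. For `n = 0` this says that `M` is Gorenstein projective; for
`n + 1` it is built by splicing `0 → K → G_0 → M → 0` with such a sequence for `K`. -/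
def HasGprojRes {R : Type u} [CommRing R] : ℕ → ModuleCat.{u} R → Prop
  | 0, M => IsGorensteinProjective M
  | n + 1, M => ∃ (G : ModuleCat.{u} R) (p : G →ₗ[R] M), IsGorensteinProjective G ∧
      Function.Surjective p ∧ HasGprojRes n (ModuleCat.of R (LinearMap.ker p))

/-- The Gorenstein projective dimension: the least length of a resolution by Gorenstein projective
modules, and `⊤` if there is no finite one. -/
def Gpd {R : Type u} [CommRing R] (M : ModuleCat.{u} R) : ℕ∞ :=
  ⨅ (n : ℕ) (_ : HasGprojRes n M), (n : ℕ∞)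

/-- The Gorenstein global dimension: the supremum of the Gorenstein projective dimensions of all
`R`-modules. -/
def Ggldim (R : Type u) [CommRing R] : ℕ∞ :=
  ⨆ M : ModuleCat.{u} R, Gpd M

end

end HomDim

/-!
Write `S = R[ε]` for the trivial extension of `R` by itself. It is free of rank two over `R`, and it
is a Frobenius extension: for an `S`-module `B` and an `R`-module `P`, taking the coordinate at `ε`
identifies `S`-linear maps `B → S ⊗ P` with `R`-linear maps `B → P` (`coind`, `ind_hom_ext`). Hence
an `S`-linear map to a projective `S`-module extends along `A → B` as soon as all `R`-linear maps
from `A` to projective `R`-modules do (`exists_extend_of_restrict`). All four statements compare a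
homological dimension of an `S`-module with that of its restriction to `R`.

*Projective dimension.* Restriction preserves projectivity. Conversely, if an `S`-module of finite
projective dimension is projective over `R`, its projective resolution splits over `R`, hence over
`S` by relative injectivity, and the module is projective (`projective_of_pdLT`). So finite
projective dimensions over `S` do not change under restriction (`pdLT_of_restrict`); together with
`pd_S (S ⊗ M) = pd_R M` this gives the equality of finitistic dimensions. The `S`-module `R` is
projective over `R` but not over `S`, so it has infinite projective dimension.

*Cotorsion dimension.* By dimension shifting, `cotD ≤ n` says that all flat modules have projective
dimension at most `n` (`cotD_le_iff`). If `K` is flat over `S` and projective over `R`, then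
`0 → ε K → K → ε K → 0` is exact and `ε K` is flat over `R`. If flat `R`-modules have bounded
projective dimension, this periodicity makes `ε K` projective, and then `K ≅ S ⊗ ε K` is projective.
A syzygy argument extends this to all flat `S`-modules (`pdLT_of_flat`).

*Gorenstein projective dimension.* A class of modules orthogonal to projective modules, each of
which embeds into a projective module with cokernel in the class, consists of Gorenstein projective
modules (`isGorensteinProjective_of_right_class`). This yields closure under extensions and under
kernels of surjections, and shows that an `S`-module `N` which is Gorenstein projective over `R`
is so over `S`: an `R`-embedding `N → P` induces an `S`-embedding `N → S ⊗ P` whose cokernel is an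
extension of `P ⧸ N` by `P` over `R`. Therefore `N` has the same Gorenstein projective dimension over
`R` and over `S` (`gpd_restrict`), for every ring `R`.
-/

namespace HomDim

open scoped DualNumber TensorProduct

/-! ### Short exact sequences of modules -/

section ShortExactSequences

variable {R : Type u} [CommRing R]

/-- `0 → A → B → C → 0` is a short exact sequence of `R`-modules. -/
structure IsSES {A B C : Type u} [AddCommGroup A] [Module R A] [AddCommGroup B] [Module R B]
    [AddCommGroup C] [Module R C] (i : A →ₗ[R] B) (p : B →ₗ[R] C) : Prop where
  injective : Function.Injective i
  exact : Function.Exact i p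
  surjective : Function.Surjective p

variable {A B C D : Type u} [AddCommGroup A] [Module R A] [AddCommGroup B] [Module R B]
    [AddCommGroup C] [Module R C] [AddCommGroup D] [Module R D]

lemma isSES_ker {p : B →ₗ[R] C} (hp : Function.Surjective p) :
    IsSES (LinearMap.ker p).subtype p :=
  ⟨Subtype.val_injective, LinearMap.exact_subtype_ker_map p, hp⟩

lemma isSES_mkQ {i : A →ₗ[R] B} (hi : Function.Injective i) :
    IsSES i (LinearMap.range i).mkQ :=
  ⟨hi, LinearMap.exact_map_mkQ_range i, Submodule.mkQ_surjective _⟩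

/-- A linear map that kills the kernel of a surjection factors through it. -/
lemma exists_factor {p : B →ₗ[R] C} (hp : Function.Surjective p) (f : B →ₗ[R] D)
    (h : ∀ b, p b = 0 → f b = 0) : ∃ g : C →ₗ[R] D, ∀ b, g (p b) = f b := by
  refine ⟨((LinearMap.ker p).liftQ f fun b hb => h b hb) ∘ₗ
    (p.quotKerEquivOfSurjective hp).symm, fun b => ?_⟩
  have : (p.quotKerEquivOfSurjective hp).symm (p b) = Submodule.Quotient.mk b := by
    rw [LinearEquiv.symm_apply_eq]; rfl
  rw [LinearMap.comp_apply, LinearEquiv.coe_coe, this]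
  rfl

namespace IsSES

variable {i : A →ₗ[R] B} {p : B →ₗ[R] C}

lemma apply_apply (h : IsSES i p) (a : A) : p (i a) = 0 := h.exact.apply_apply_eq_zero a

lemma exists_lift (h : IsSES i p) {b : B} (hb : p b = 0) : ∃ a, i a = b := (h.exact b).1 hb

lemma exists_map_lift (h : IsSES i p) (f : D →ₗ[R] B) (hf : ∀ d, p (f d) = 0) :
    ∃ g : D →ₗ[R] A, ∀ d, i (g d) = f d := by
  refine ⟨(LinearEquiv.ofInjective i h.injective).symm.toLinearMap ∘ₗ
    f.codRestrict (LinearMap.range i) fun d => (h.exact _).1 (hf d), fun d => ?_⟩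
  have := LinearEquiv.apply_symm_apply (LinearEquiv.ofInjective i h.injective)
    (f.codRestrict (LinearMap.range i) (fun d => (h.exact _).1 (hf d)) d)
  exact congrArg Subtype.val this

lemma exists_equiv_ker (h : IsSES i p) : Nonempty (A ≃ₗ[R] LinearMap.ker p) :=
  ⟨(LinearEquiv.ofInjective i h.injective).trans
    (LinearEquiv.ofEq _ _ (LinearMap.exact_iff.1 h.exact).symm)⟩

lemma shortExact (h : IsSES i p) :
    (ShortComplex.mk (ModuleCat.ofHom i) (ModuleCat.ofHom p) (by
      ext a; exact h.apply_apply a)).ShortExact where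
  exact := by
    rw [ShortComplex.ShortExact.moduleCat_exact_iff_function_exact]
    exact h.exact
  mono_f := (ModuleCat.mono_iff_injective _).2 h.injective
  epi_g := (ModuleCat.epi_iff_surjective _).2 h.surjective

/-- A short exact sequence with projective quotient splits. -/
lemma exists_retraction_of_projective (h : IsSES i p) [Module.Projective R C] :
    ∃ r : B →ₗ[R] A, ∀ a, r (i a) = a := by
  obtain ⟨s, hs⟩ := Module.projective_lifting_property p LinearMap.id h.surjective
  have hs' : ∀ c, p (s c) = c := fun c => LinearMap.congr_fun hs c
  obtain ⟨r, hr⟩ := h.exists_map_lift (LinearMap.id - s ∘ₗ p) fun b => by simp [hs']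
  exact ⟨r, fun a => h.injective (by simp [hr, h.apply_apply])⟩

/-- The quotient of a split short exact sequence is a direct summand of the middle term. -/
lemma projective_of_retraction (h : IsSES i p) [Module.Projective R B] (r : B →ₗ[R] A)
    (hr : ∀ a, r (i a) = a) : Module.Projective R C := by
  obtain ⟨s, hs⟩ := exists_factor h.surjective (LinearMap.id - i ∘ₗ r) fun b hb => by
    obtain ⟨a, rfl⟩ := h.exists_lift hb
    simp [hr]
  refine Module.Projective.of_split s p (LinearMap.ext fun c => ?_)
  obtain ⟨b, rfl⟩ := h.surjective c
  simp [hs, h.apply_apply]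

lemma projective_left (h : IsSES i p) [Module.Projective R B] [Module.Projective R C] :
    Module.Projective R A := by
  obtain ⟨r, hr⟩ := h.exists_retraction_of_projective
  exact Module.Projective.of_split i r (LinearMap.ext hr)

end IsSES

variable (R) in
/-- Every module is a quotient of a projective module. -/
lemma exists_projective_surjective (M : Type u) [AddCommGroup M] [Module R M] :
    ∃ (P : ModuleCat.{u} R) (p : P →ₗ[R] M), Module.Projective R P ∧ Function.Surjective p :=
  ⟨ModuleCat.of R (M →₀ R), Finsupp.linearCombination R id,
    inferInstanceAs (Module.Projective R (M →₀ R)),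
    Finsupp.linearCombination_id_surjective R M⟩

end ShortExactSequences

/-! ### Projective dimension and short exact sequences -/

section ProjectiveDimension

variable {R : Type u} [CommRing R]
variable {A B C : Type u} [AddCommGroup A] [Module R A] [AddCommGroup B] [Module R B]
    [AddCommGroup C] [Module R C] {i : A →ₗ[R] B} {p : B →ₗ[R] C}

variable (R) in
/-- The projective dimension of the `R`-module `M` is less than `n`. -/
abbrev PdLT (M : Type u) [AddCommGroup M] [Module R M] (n : ℕ) : Prop :=
  HasProjectiveDimensionLT (ModuleCat.of R M) n

lemma pdLT_zero_iff : PdLT R A 0 ↔ Subsingleton A := by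
  rw [PdLT, hasProjectiveDimensionLT_zero_iff_isZero, ModuleCat.isZero_iff_subsingleton]

lemma pdLT_one_iff : PdLT R A 1 ↔ Module.Projective R A := by
  rw [PdLT, ← projective_iff_hasProjectiveDimensionLT_one, IsProjective.iff_projective]

lemma IsSES.pdLT_succ_iff (h : IsSES i p) [Module.Projective R B] (n : ℕ) :
    PdLT R C (n + 2) ↔ PdLT R A (n + 1) :=
  h.shortExact.hasProjectiveDimensionLT_X₃_iff n
    ((IsProjective.iff_projective _).1 inferInstance)

lemma pdLT_of_retract (i : A →ₗ[R] B) (r : B →ₗ[R] A) (h : ∀ a, r (i a) = a) {n : ℕ}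
    (hB : PdLT R B n) : PdLT R A n :=
  Retract.hasProjectiveDimensionLT (X := ModuleCat.of R A) (Y := ModuleCat.of R B)
    ⟨ModuleCat.ofHom i, ModuleCat.ofHom r, by ext a; exact h a⟩ n

end ProjectiveDimension

/-! ### Modules orthogonal to projective modules -/

section ProjectiveOrthogonal

variable {R : Type u} [CommRing R]

variable (R) in
/-- `Ext^n(M, Q) = 0` for every `n ≥ 1` and every projective module `Q`. -/
def ProjOrth (M : Type u) [AddCommGroup M] [Module R M] : Prop :=
  ∀ Q : ModuleCat.{u} R, Module.Projective R Q → ∀ n : ℕ,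
    Subsingleton (Abelian.Ext.{u} (ModuleCat.of R M) Q (n + 1))

variable {A B C : Type u} [AddCommGroup A] [Module R A] [AddCommGroup B] [Module R B]
    [AddCommGroup C] [Module R C] {i : A →ₗ[R] B} {p : B →ₗ[R] C}

lemma projective_subsingleton_ext [hA : Module.Projective R A] (Q : ModuleCat.{u} R) (n : ℕ) :
    Subsingleton (Abelian.Ext.{u} (ModuleCat.of R A) Q (n + 1)) :=
  have := pdLT_one_iff.2 hA
  HasProjectiveDimensionLT.subsingleton (ModuleCat.of R A) 1 (n + 1) (by omega) Q

lemma IsSES.subsingleton_ext_middle (h : IsSES i p) (Q : ModuleCat.{u} R) (n : ℕ)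
    (hA : Subsingleton (Abelian.Ext.{u} (ModuleCat.of R A) Q n))
    (hC : Subsingleton (Abelian.Ext.{u} (ModuleCat.of R C) Q n)) :
    Subsingleton (Abelian.Ext.{u} (ModuleCat.of R B) Q n) := by
  refine subsingleton_of_forall_eq 0 fun x => ?_
  obtain ⟨y, rfl⟩ := Abelian.Ext.contravariant_sequence_exact₂ h.shortExact Q x
    (hA.elim _ _)
  rw [hC.elim y 0, Abelian.Ext.comp_zero]

lemma IsSES.subsingleton_ext_right (h : IsSES i p) (Q : ModuleCat.{u} R) (n : ℕ)
    (hA : Subsingleton (Abelian.Ext.{u} (ModuleCat.of R A) Q n))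
    (hB : Subsingleton (Abelian.Ext.{u} (ModuleCat.of R B) Q (n + 1))) :
    Subsingleton (Abelian.Ext.{u} (ModuleCat.of R C) Q (n + 1)) := by
  refine subsingleton_of_forall_eq 0 fun x => ?_
  obtain ⟨y, rfl⟩ := Abelian.Ext.contravariant_sequence_exact₃ h.shortExact Q x
    (hB.elim _ _) (add_comm 1 n)
  rw [hA.elim y 0, Abelian.Ext.comp_zero]

lemma IsSES.subsingleton_ext_left (h : IsSES i p) (Q : ModuleCat.{u} R) (n : ℕ)
    (hB : Subsingleton (Abelian.Ext.{u} (ModuleCat.of R B) Q n))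
    (hC : Subsingleton (Abelian.Ext.{u} (ModuleCat.of R C) Q (n + 1))) :
    Subsingleton (Abelian.Ext.{u} (ModuleCat.of R A) Q n) := by
  refine subsingleton_of_forall_eq 0 fun x => ?_
  obtain ⟨y, rfl⟩ := Abelian.Ext.contravariant_sequence_exact₁ h.shortExact Q x
    (add_comm 1 n) (hC.elim _ _)
  rw [hB.elim y 0, Abelian.Ext.comp_zero]

/-- If every map `A → Q` extends to the projective module `B`, then `Ext^1(B ⧸ A, Q) = 0`. -/
lemma IsSES.subsingleton_ext_one (h : IsSES i p) [Module.Projective R B] (Q : ModuleCat.{u} R)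
    (hext : ∀ f : A →ₗ[R] Q, ∃ g : B →ₗ[R] Q, ∀ a, g (i a) = f a) :
    Subsingleton (Abelian.Ext.{u} (ModuleCat.of R C) Q 1) := by
  refine subsingleton_of_forall_eq 0 fun x => ?_
  obtain ⟨y, rfl⟩ := Abelian.Ext.contravariant_sequence_exact₃ h.shortExact Q x
    ((projective_subsingleton_ext (A := B) Q 0).elim _ _) (add_comm 1 0)
  obtain ⟨f, rfl⟩ := Abelian.Ext.homEquiv₀.symm.surjective y
  obtain ⟨g, hg⟩ := hext f.hom
  have : f = ModuleCat.ofHom i ≫ ModuleCat.ofHom g := by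
    ext a; exact (hg a).symm
  subst this
  rw [Abelian.Ext.homEquiv₀_symm_apply, ← Abelian.Ext.mk₀_comp_mk₀]
  exact h.shortExact.extClass_comp_assoc _

lemma IsSES.exists_extend (h : IsSES i p) (Q : ModuleCat.{u} R)
    (hC : Subsingleton (Abelian.Ext.{u} (ModuleCat.of R C) Q 1)) (f : A →ₗ[R] Q) :
    ∃ g : B →ₗ[R] Q, ∀ a, g (i a) = f a := by
  obtain ⟨y, hy⟩ := Abelian.Ext.contravariant_sequence_exact₁ h.shortExact Q
    (Abelian.Ext.mk₀ (ModuleCat.ofHom f)) (add_comm 1 0) (hC.elim _ _)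
  obtain ⟨g, rfl⟩ := Abelian.Ext.homEquiv₀.symm.surjective y
  rw [Abelian.Ext.homEquiv₀_symm_apply, Abelian.Ext.mk₀_comp_mk₀] at hy
  have := Abelian.Ext.homEquiv₀.symm.injective hy
  exact ⟨g.hom, fun a => congrArg (fun q => q.hom a) this⟩

lemma projOrth_of_projective [Module.Projective R A] : ProjOrth R A :=
  fun Q _ n => projective_subsingleton_ext Q n

lemma IsSES.projOrth_middle (h : IsSES i p) (hA : ProjOrth R A) (hC : ProjOrth R C) :
    ProjOrth R B :=
  fun Q hQ n => h.subsingleton_ext_middle Q _ (hA Q hQ n) (hC Q hQ n)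

lemma IsSES.projOrth_left (h : IsSES i p) (hB : ProjOrth R B) (hC : ProjOrth R C) :
    ProjOrth R A :=
  fun Q hQ n => h.subsingleton_ext_left Q _ (hB Q hQ n) (hC Q hQ (n + 1))

lemma ProjOrth.exists_extend (hC : ProjOrth R C) (h : IsSES i p) {Q : Type u} [AddCommGroup Q]
    [Module R Q] [hQ : Module.Projective R Q] (f : A →ₗ[R] Q) :
    ∃ g : B →ₗ[R] Q, ∀ a, g (i a) = f a :=
  IsSES.exists_extend h (ModuleCat.of R Q) (hC (ModuleCat.of R Q) hQ 0) f

/-- Dimension shifting: if each member of a class of modules is a quotient of a projective module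
by a member of the class from which maps to projective modules extend, then all members are
orthogonal to projective modules. -/
lemma projOrth_of_syzygies (𝒞 : ModuleCat.{u} R → Prop)
    (h : ∀ M, 𝒞 M → ∃ (K P : ModuleCat.{u} R) (i : K →ₗ[R] P) (p : P →ₗ[R] M), 𝒞 K ∧
      Module.Projective R P ∧ IsSES i p ∧ ∀ Q : ModuleCat.{u} R, Module.Projective R Q →
        ∀ f : K →ₗ[R] Q, ∃ g : P →ₗ[R] Q, ∀ a, g (i a) = f a)
    (M : ModuleCat.{u} R) (hM : 𝒞 M) : ProjOrth R M := by
  intro Q hQ n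
  induction n generalizing M with
  | zero =>
    obtain ⟨K, P, i, p, -, hP, hs, he⟩ := h M hM
    exact hs.subsingleton_ext_one Q (he Q hQ)
  | succ n ih =>
    obtain ⟨K, P, i, p, hK, hP, hs, -⟩ := h M hM
    exact hs.subsingleton_ext_right Q _ (ih K hK) (projective_subsingleton_ext Q (n + 1))

end ProjectiveOrthogonal

/-! ### Gorenstein projective modules -/

section GorensteinProjective

variable {R : Type u} [CommRing R]

/-- A relation on a type in which every element has a successor and a predecessor has a
two-sided infinite chain through every element. The element sits at index `1`, the index of the
image of the differential `P 0 → P 1` in a complete resolution. -/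
lemma exists_int_chain {α : Type*} (r : α → α → Prop) (hs : ∀ a, ∃ b, r a b)
    (hp : ∀ b, ∃ a, r a b) (a : α) : ∃ x : ℤ → α, x 1 = a ∧ ∀ i, r (x i) (x (i + 1)) := by
  choose s hs using hs
  choose t ht using hp
  let x : ℤ → α := fun i => match i with
    | .ofNat n => s^[n] a
    | .negSucc n => t^[n + 1] a
  suffices hx : ∀ i, r (x i) (x (i + 1)) by
    refine ⟨fun i => x (i - 1), rfl, fun i => ?_⟩
    have := hx (i - 1)
    rwa [show i - 1 + 1 = i + 1 - 1 by ring] at this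
  intro i
  match i with
  | .ofNat n =>
    change r (s^[n] a) (s^[n + 1] a)
    rw [Function.iterate_succ_apply']
    exact hs _
  | .negSucc 0 => exact ht a
  | .negSucc (n + 1) =>
    change r (t^[n + 2] a) (t^[n + 1] a)
    rw [Function.iterate_succ_apply' t (n + 1)]
    exact ht _

/-- A module in a class of modules orthogonal to projective modules, all of whose members admit
short exact sequences `0 → M → P → M' → 0` and `0 → M' → P → M → 0` with `P` projective and `M'`
in the class, is Gorenstein projective. -/
lemma isGorensteinProjective_of_class (𝒞 : ModuleCat.{u} R → Prop)
    (hr : ∀ M, 𝒞 M → ∃ (P N : ModuleCat.{u} R) (i : M →ₗ[R] P) (p : P →ₗ[R] N), 𝒞 N ∧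
      Module.Projective R P ∧ IsSES i p)
    (hl : ∀ M, 𝒞 M → ∃ (N P : ModuleCat.{u} R) (i : N →ₗ[R] P) (p : P →ₗ[R] M), 𝒞 N ∧
      Module.Projective R P ∧ IsSES i p)
    (ho : ∀ M, 𝒞 M → ProjOrth R M) (M : ModuleCat.{u} R) (hM : 𝒞 M) :
    IsGorensteinProjective M := by
  obtain ⟨x, hx₀, hx⟩ := exists_int_chain
    (fun a b : {M : ModuleCat.{u} R // 𝒞 M} => ∃ (P : ModuleCat.{u} R) (i : a.1 →ₗ[R] P)
      (p : P →ₗ[R] b.1), Module.Projective R P ∧ IsSES i p)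
    (fun a => by
      obtain ⟨P, N, i, p, hN, hP, h⟩ := hr a.1 a.2
      exact ⟨⟨N, hN⟩, P, i, p, hP, h⟩)
    (fun a => by
      obtain ⟨N, P, i, p, hN, hP, h⟩ := hl a.1 a.2
      exact ⟨⟨N, hN⟩, P, i, p, hP, h⟩)
    ⟨M, hM⟩
  choose P ι π hP hs using hx
  have hM' : M = (x 1).1 := by rw [hx₀]
  subst hM'
  have hinj : ∀ j, Function.Injective (ι j) := fun j => (hs j).injective
  have hsurj : ∀ j, Function.Surjective (π j) := fun j => (hs j).surjective
  refine ⟨P, fun j => ι (j + 1) ∘ₗ π j, ⟨hP, fun j => ?_, fun Q hQ j f => ?_⟩, ?_⟩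
  · intro b
    constructor
    · intro hb
      have hb' : π (j + 1) b = 0 := hinj _ (by simpa using hb)
      obtain ⟨a, rfl⟩ := (hs (j + 1)).exists_lift hb'
      obtain ⟨c, rfl⟩ := hsurj j a
      exact ⟨c, rfl⟩
    · rintro ⟨c, rfl⟩
      simp [(hs (j + 1)).apply_apply]
  · constructor
    · intro hf
      obtain ⟨h, hh⟩ := exists_factor (hsurj (j + 1)) f fun b hb => by
        obtain ⟨a, rfl⟩ := (hs (j + 1)).exists_lift hb
        obtain ⟨c, rfl⟩ := hsurj j a
        exact LinearMap.congr_fun hf c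
      obtain ⟨g, hg⟩ := (ho _ (x (j + 1 + 1 + 1)).2).exists_extend (hs (j + 1 + 1)) h
      exact ⟨g, LinearMap.ext fun b => by simp [hg, hh]⟩
    · rintro ⟨g, rfl⟩
      ext c
      simp [(hs (j + 1)).apply_apply]
  · refine ⟨(LinearEquiv.ofInjective _ (hinj 1)).trans (LinearEquiv.ofEq _ _ ?_)⟩
    exact (LinearMap.range_comp_of_range_eq_top _ (LinearMap.range_eq_top.2 (hsurj 0))).symm

variable {A B C D : Type u} [AddCommGroup A] [Module R A] [AddCommGroup B] [Module R B]
    [AddCommGroup C] [Module R C] [AddCommGroup D] [Module R D] {i : A →ₗ[R] B} {p : B →ₗ[R] C}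

variable (R) in
/-- The unbundled form of `IsGorensteinProjective`. -/
abbrev GProj (M : Type u) [AddCommGroup M] [Module R M] : Prop :=
  IsGorensteinProjective (ModuleCat.of R M)

lemma GProj.of_equiv (hA : GProj R A) (e : A ≃ₗ[R] B) : GProj R B := by
  obtain ⟨P, d, hP, ⟨f⟩⟩ := hA
  exact ⟨P, d, hP, ⟨e.symm.trans f⟩⟩

/-- The image of any differential of a complete projective resolution. -/
def IsSyzygyOfComplete (M : ModuleCat.{u} R) : Prop :=
  ∃ (P : ℤ → ModuleCat.{u} R) (d : ∀ i : ℤ, P i →ₗ[R] P (i + 1)) (j : ℤ),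
    IsCompleteProjRes P d ∧ Nonempty (M ≃ₗ[R] LinearMap.range (d j))

lemma isSES_range {P : ℤ → ModuleCat.{u} R} {d : ∀ i : ℤ, P i →ₗ[R] P (i + 1)}
    (h : IsCompleteProjRes P d) (j : ℤ) :
    IsSES (LinearMap.range (d j)).subtype (d (j + 1)).rangeRestrict := by
  refine ⟨Subtype.val_injective, fun b => ?_, LinearMap.surjective_rangeRestrict _⟩
  have := h.exact j b
  rw [← Subtype.val_inj]
  simpa using this

/-- Replace the outer terms of a short exact sequence by isomorphic modules. -/
lemma IsSES.congr (h : IsSES i p) {A' C' : Type u} [AddCommGroup A'] [Module R A']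
    [AddCommGroup C'] [Module R C'] (e : A' ≃ₗ[R] A) (f : C ≃ₗ[R] C') :
    IsSES (i ∘ₗ e.toLinearMap) (f.toLinearMap ∘ₗ p) where
  injective := h.injective.comp e.injective
  exact b := by
    constructor
    · intro hb
      obtain ⟨a, rfl⟩ := h.exists_lift (b := b) (f.injective (by simpa using hb))
      exact ⟨e.symm a, by simp⟩
    · rintro ⟨a, rfl⟩
      simp [h.apply_apply]
  surjective := f.surjective.comp h.surjective

lemma IsSyzygyOfComplete.exists_right {M : ModuleCat.{u} R} (hM : IsSyzygyOfComplete M) :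
    ∃ (P N : ModuleCat.{u} R) (i : M →ₗ[R] P) (p : P →ₗ[R] N), IsSyzygyOfComplete N ∧
      Module.Projective R P ∧ IsSES i p := by
  obtain ⟨P, d, j, h, ⟨e⟩⟩ := hM
  exact ⟨P (j + 1), ModuleCat.of R (LinearMap.range (d (j + 1))), _, _,
    ⟨P, d, j + 1, h, ⟨LinearEquiv.refl _ _⟩⟩, h.projective _,
    (isSES_range h j).congr e (LinearEquiv.refl _ _)⟩

lemma IsSyzygyOfComplete.exists_left {M : ModuleCat.{u} R} (hM : IsSyzygyOfComplete M) :
    ∃ (N P : ModuleCat.{u} R) (i : N →ₗ[R] P) (p : P →ₗ[R] M), IsSyzygyOfComplete N ∧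
      Module.Projective R P ∧ IsSES i p ∧ ∀ Q : ModuleCat.{u} R, Module.Projective R Q →
        ∀ f : N →ₗ[R] Q, ∃ g : P →ₗ[R] Q, ∀ a, g (i a) = f a := by
  obtain ⟨P, d, j, h, ⟨e⟩⟩ := hM
  obtain ⟨k, rfl⟩ : ∃ k : ℤ, j = k + 1 + 1 := ⟨j - 2, by ring⟩
  refine ⟨ModuleCat.of R (LinearMap.range (d (k + 1))), P (k + 1 + 1), _, _,
    ⟨P, d, k + 1, h, ⟨LinearEquiv.refl _ _⟩⟩, h.projective _,
    (isSES_range h (k + 1)).congr (LinearEquiv.refl _ _) e.symm, fun Q hQ f => ?_⟩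
  obtain ⟨g, hg⟩ := (h.hom_exact Q hQ k (f ∘ₗ (d (k + 1)).rangeRestrict)).1 (by
    ext c
    have : (d (k + 1)).rangeRestrict (d k c) = 0 := Subtype.ext ((h.exact k).apply_apply_eq_zero c)
    simp [this])
  refine ⟨g, ?_⟩
  rintro ⟨_, c, rfl⟩
  exact LinearMap.congr_fun hg c

lemma IsSyzygyOfComplete.projOrth {M : ModuleCat.{u} R} (hM : IsSyzygyOfComplete M) :
    ProjOrth R M :=
  projOrth_of_syzygies _ (fun _ h => h.exists_left) M hM

lemma IsSyzygyOfComplete.isGorensteinProjective {M : ModuleCat.{u} R}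
    (hM : IsSyzygyOfComplete M) : IsGorensteinProjective M :=
  isGorensteinProjective_of_class IsSyzygyOfComplete (fun _ h => h.exists_right)
    (fun _ h => by
      obtain ⟨N, P, i, p, hN, hP, hs, -⟩ := h.exists_left
      exact ⟨N, P, i, p, hN, hP, hs⟩)
    (fun _ h => h.projOrth) M hM

lemma isSyzygyOfComplete_of_isGorensteinProjective {M : ModuleCat.{u} R}
    (hM : IsGorensteinProjective M) : IsSyzygyOfComplete M := by
  obtain ⟨P, d, h, e⟩ := hM
  exact ⟨P, d, 0, h, e⟩

lemma GProj.projOrth (hA : GProj R A) : ProjOrth R A :=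
  (isSyzygyOfComplete_of_isGorensteinProjective hA).projOrth

lemma GProj.exists_right (hA : GProj R A) :
    ∃ (P N : ModuleCat.{u} R) (i : A →ₗ[R] P) (p : P →ₗ[R] N), IsGorensteinProjective N ∧
      Module.Projective R P ∧ IsSES i p := by
  obtain ⟨P, N, i, p, hN, hP, h⟩ :=
    (isSyzygyOfComplete_of_isGorensteinProjective hA).exists_right
  exact ⟨P, N, i, p, hN.isGorensteinProjective, hP, h⟩

/-- The closure of a class of modules under kernels of surjections from projective modules. -/
inductive SyzygyClosure (𝒞 : ModuleCat.{u} R → Prop) : ModuleCat.{u} R → Prop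
  | base (M : ModuleCat.{u} R) (h : 𝒞 M) : SyzygyClosure 𝒞 M
  | step (K P M : ModuleCat.{u} R) (i : K →ₗ[R] P) (p : P →ₗ[R] M) (hP : Module.Projective R P)
      (h : IsSES i p) (hM : SyzygyClosure 𝒞 M) : SyzygyClosure 𝒞 K

/-- For a class of modules orthogonal to projective modules, embeddings into projective modules
with cokernel in the class are enough for its members to be Gorenstein projective: the other half
of a complete resolution is any projective resolution. -/
lemma isGorensteinProjective_of_right_class (𝒞 : ModuleCat.{u} R → Prop)
    (hr : ∀ M, 𝒞 M → ∃ (P N : ModuleCat.{u} R) (i : M →ₗ[R] P) (p : P →ₗ[R] N), 𝒞 N ∧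
      Module.Projective R P ∧ IsSES i p)
    (ho : ∀ M, 𝒞 M → ProjOrth R M) (M : ModuleCat.{u} R) (hM : 𝒞 M) :
    IsGorensteinProjective M := by
  refine isGorensteinProjective_of_class (SyzygyClosure 𝒞) ?_ ?_ ?_ M (.base M hM)
  · rintro M (⟨_, h⟩ | ⟨_, P, N, i, p, hP, h, hN⟩)
    · obtain ⟨P, N, i, p, hN, hP, hs⟩ := hr M h
      exact ⟨P, N, i, p, .base N hN, hP, hs⟩
    · exact ⟨P, N, i, p, hN, hP, h⟩
  · intro M hM
    obtain ⟨P, p, hP, hp⟩ := exists_projective_surjective R M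
    exact ⟨ModuleCat.of R (LinearMap.ker p), P, _, p,
      .step _ P M _ p hP (isSES_ker hp) hM, hP, isSES_ker hp⟩
  · intro M hM
    induction hM with
    | base M h => exact ho M h
    | step K P M i p hP h _ ih => exact h.projOrth_left projOrth_of_projective ih

lemma gproj_of_projective [hA : Module.Projective R A] : GProj R A := by
  refine isGorensteinProjective_of_right_class (fun M => Module.Projective R M)
    (fun M hM => ⟨M, ModuleCat.of R PUnit, LinearMap.id, 0, ?_, hM, ?_⟩)
    (fun M hM => projOrth_of_projective) _ hA
  · exact inferInstanceAs (Module.Projective R PUnit.{u + 1})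
  · exact ⟨Function.injective_id, fun b => by simp, fun c => ⟨0, Subsingleton.elim _ _⟩⟩

/-- The kernel of a surjection from a projective module to a Gorenstein projective module is
Gorenstein projective. -/
lemma GProj.ker_of_projective (hC : GProj R C) (h : IsSES i p) [hB : Module.Projective R B] :
    GProj R A := by
  refine isGorensteinProjective_of_right_class
    (fun M => ProjOrth R M ∧ ∃ (P N : ModuleCat.{u} R) (i : M →ₗ[R] P) (p : P →ₗ[R] N),
      IsGorensteinProjective N ∧ Module.Projective R P ∧ IsSES i p)
    ?_ (fun M hM => hM.1) (ModuleCat.of R A)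
    ⟨h.projOrth_left projOrth_of_projective hC.projOrth, ModuleCat.of R B, ModuleCat.of R C, i, p,
      hC, hB, h⟩
  rintro M ⟨-, P, N, i, p, hN, hP, h⟩
  exact ⟨P, N, i, p, ⟨GProj.projOrth hN, GProj.exists_right hN⟩, hP, h⟩

/-- An extension of `C` by `A` embeds into the sum of projective modules containing `A` and `C`,
and the cokernel is again an extension of the cokernels. -/
lemma IsSES.exists_embedding (h : IsSES i p) (hC : ProjOrth R C)
    {P A' Q C' : Type u} [AddCommGroup P] [Module R P] [AddCommGroup A'] [Module R A']
    [AddCommGroup Q] [Module R Q] [AddCommGroup C'] [Module R C'] [Module.Projective R P]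
    {a : A →ₗ[R] P} {a' : P →ₗ[R] A'} (ha : IsSES a a')
    {c : C →ₗ[R] Q} {c' : Q →ₗ[R] C'} (hc : IsSES c c') :
    ∃ (φ : B →ₗ[R] P × Q) (j : A' →ₗ[R] (P × Q) ⧸ LinearMap.range φ)
      (q : ((P × Q) ⧸ LinearMap.range φ) →ₗ[R] C'), Function.Injective φ ∧ IsSES j q := by
  obtain ⟨α, hα⟩ := hC.exists_extend h a
  let φ : B →ₗ[R] P × Q := α.prod (c ∘ₗ p)
  have hφ : IsSES φ (LinearMap.range φ).mkQ := by
    refine isSES_mkQ ((injective_iff_map_eq_zero φ).2 fun b hb => ?_)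
    have h1 : α b = 0 := congrArg Prod.fst hb
    have h2 : c (p b) = 0 := congrArg Prod.snd hb
    obtain ⟨x, rfl⟩ := h.exists_lift ((injective_iff_map_eq_zero c).1 hc.injective _ h2)
    rw [hα] at h1
    rw [(injective_iff_map_eq_zero a).1 ha.injective _ h1, map_zero]
  obtain ⟨j, hj⟩ := exists_factor ha.surjective
    ((LinearMap.range φ).mkQ ∘ₗ LinearMap.inl R P Q) fun x hx => by
      obtain ⟨y, rfl⟩ := ha.exists_lift hx
      have : LinearMap.inl R P Q (a y) = φ (i y) :=
        Prod.ext (hα y).symm (by simp [φ, h.apply_apply])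
      rw [LinearMap.comp_apply, this, hφ.apply_apply]
  obtain ⟨q, hq⟩ := exists_factor hφ.surjective (c' ∘ₗ LinearMap.snd R P Q) fun z hz => by
    obtain ⟨b, rfl⟩ := hφ.exists_lift hz
    exact hc.apply_apply _
  refine ⟨φ, j, q, hφ.injective, (injective_iff_map_eq_zero j).2 fun x' hx => ?_, fun z' => ?_,
    fun y' => ?_⟩
  · obtain ⟨x, rfl⟩ := ha.surjective x'
    rw [hj] at hx
    obtain ⟨b, hb⟩ := hφ.exists_lift hx
    have h1 : α b = x := congrArg Prod.fst hb
    have h2 : c (p b) = 0 := congrArg Prod.snd hb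
    obtain ⟨y, rfl⟩ := h.exists_lift ((injective_iff_map_eq_zero c).1 hc.injective _ h2)
    rw [← h1, hα, ha.apply_apply]
  · obtain ⟨⟨x, y⟩, rfl⟩ := hφ.surjective z'
    constructor
    · intro hz
      rw [hq] at hz
      obtain ⟨w, hw⟩ := hc.exists_lift hz
      obtain ⟨b, rfl⟩ := h.surjective w
      refine ⟨a' (x - α b), ?_⟩
      rw [hj, LinearMap.comp_apply, ← sub_eq_zero, ← map_sub]
      have : LinearMap.inl R P Q (x - α b) - (x, y) = φ (-b) := by
        ext
        · simp [φ]
        · simpa [φ] using hw.symm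
      rw [this, hφ.apply_apply]
    · rintro ⟨x', hx'⟩
      obtain ⟨x₀, rfl⟩ := ha.surjective x'
      rw [← hx', hj, LinearMap.comp_apply, hq]
      simp
  · obtain ⟨y, rfl⟩ := hc.surjective y'
    exact ⟨(LinearMap.range φ).mkQ (0, y), by rw [hq]; rfl⟩

/-- Gorenstein projective modules are closed under extensions. -/
lemma IsSES.gproj_middle (h : IsSES i p) (hA : GProj R A) (hC : GProj R C) : GProj R B := by
  refine isGorensteinProjective_of_right_class
    (fun M => ∃ (A C : ModuleCat.{u} R) (i : A →ₗ[R] M) (p : M →ₗ[R] C),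
      IsGorensteinProjective A ∧ IsGorensteinProjective C ∧ IsSES i p)
    ?_ ?_ (ModuleCat.of R B) ⟨ModuleCat.of R A, ModuleCat.of R C, i, p, hA, hC, h⟩
  · rintro M ⟨A, C, i, p, hA, hC, h⟩
    obtain ⟨P, A', a, a', hA', hP, ha⟩ := GProj.exists_right hA
    obtain ⟨Q, C', c, c', hC', hQ, hc⟩ := GProj.exists_right hC
    obtain ⟨φ, j, q, hφ, hjq⟩ := h.exists_embedding (GProj.projOrth hC) ha hc
    exact ⟨ModuleCat.of R (P × Q), ModuleCat.of R ((P × Q) ⧸ LinearMap.range φ), φ, _,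
      ⟨A', C', j, q, hA', hC', hjq⟩, inferInstanceAs (Module.Projective R (P × Q)),
      isSES_mkQ hφ⟩
  · rintro M ⟨A, C, i, p, hA, hC, h⟩
    exact h.projOrth_middle (GProj.projOrth hA) (GProj.projOrth hC)

/-- The kernel of a surjection between Gorenstein projective modules is Gorenstein projective. -/
lemma IsSES.gproj_left (h : IsSES i p) (hB : GProj R B) (hC : GProj R C) : GProj R A := by
  obtain ⟨P, B', b, b', hB', hP, hb⟩ := GProj.exists_right hB
  -- `P ⧸ A` is an extension of `P ⧸ B` by `B ⧸ A = C`.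
  have hA : IsSES (b ∘ₗ i) (LinearMap.range (b ∘ₗ i)).mkQ :=
    isSES_mkQ (hb.injective.comp h.injective)
  obtain ⟨j, hj⟩ := exists_factor h.surjective ((LinearMap.range (b ∘ₗ i)).mkQ ∘ₗ b)
    fun x hx => by
      obtain ⟨y, rfl⟩ := h.exists_lift hx
      exact hA.apply_apply y
  obtain ⟨q, hq⟩ := exists_factor hA.surjective b' fun x hx => by
    obtain ⟨y, rfl⟩ := hA.exists_lift hx
    exact hb.apply_apply _
  refine GProj.ker_of_projective (IsSES.gproj_middle (i := j) (p := q) ⟨?_, ?_, ?_⟩ hC hB') hA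
  · refine (injective_iff_map_eq_zero j).2 fun c hc => ?_
    obtain ⟨x, rfl⟩ := h.surjective c
    rw [hj] at hc
    obtain ⟨y, hy⟩ := hA.exists_lift hc
    rw [← hb.injective hy, h.apply_apply]
  · intro z
    obtain ⟨x, rfl⟩ := hA.surjective z
    constructor
    · intro hz
      rw [hq] at hz
      obtain ⟨y, rfl⟩ := hb.exists_lift hz
      exact ⟨p y, hj y⟩
    · rintro ⟨c, hc⟩
      obtain ⟨y, rfl⟩ := h.surjective c
      rw [← hc, hj, LinearMap.comp_apply, hq, hb.apply_apply]
  · intro y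
    obtain ⟨x, rfl⟩ := hb.surjective y
    exact ⟨_, hq x⟩

end GorensteinProjective

/-! ### Resolutions by Gorenstein projective modules -/

section GorensteinResolutions

variable {R : Type u} [CommRing R]
variable {A B C : Type u} [AddCommGroup A] [Module R A] [AddCommGroup B] [Module R B]
    [AddCommGroup C] [Module R C] {i : A →ₗ[R] B} {p : B →ₗ[R] C}

variable (R) in
/-- The unbundled form of `HasGprojRes`. -/
abbrev GRes (n : ℕ) (M : Type u) [AddCommGroup M] [Module R M] : Prop :=
  HasGprojRes n (ModuleCat.of R M)

lemma GRes.of_equiv {n : ℕ} (h : GRes R n A) (e : A ≃ₗ[R] B) : GRes R n B := by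
  induction n generalizing A B with
  | zero => exact GProj.of_equiv h e
  | succ n ih =>
    obtain ⟨G, p, hG, hp, hK⟩ := h
    exact ⟨G, e.toLinearMap ∘ₗ p, hG, e.surjective.comp hp,
      ih hK (LinearEquiv.ofEq _ _ (LinearEquiv.ker_comp e p).symm)⟩

lemma IsSES.gRes_succ {n : ℕ} (h : IsSES i p) (hB : GProj R B) (hA : GRes R n A) :
    GRes R (n + 1) C :=
  ⟨ModuleCat.of R B, p, hB, h.surjective, GRes.of_equiv hA h.exists_equiv_ker.some⟩

lemma IsSES.gRes_left {n : ℕ} (h : IsSES i p) (hB : GRes R n B) (hC : GProj R C) :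
    GRes R n A := by
  cases n with
  | zero => exact h.gproj_left hB hC
  | succ n =>
    obtain ⟨G, q, hG, hq, hK⟩ := hB
    -- The preimage `L` of `A` in `G` is the kernel of `G → C`, and `L → A` has kernel `ker q`.
    have hL := isSES_ker (p := p ∘ₗ q) (h.surjective.comp hq)
    obtain ⟨t, ht⟩ := h.exists_map_lift (q ∘ₗ (LinearMap.ker (p ∘ₗ q)).subtype) fun x => x.2
    obtain ⟨s, hs⟩ := hL.exists_map_lift (LinearMap.ker q).subtype fun x => by
      simp [LinearMap.mem_ker.1 x.2]
    refine IsSES.gRes_succ (i := s) (p := t) ⟨?_, ?_, ?_⟩ (hL.gproj_left hG hC) hK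
    · intro x y hxy
      have := congrArg (LinearMap.ker (p ∘ₗ q)).subtype hxy
      rw [hs, hs] at this
      exact Subtype.ext this
    · intro x
      constructor
      · intro hx
        have h1 : q x.1 = 0 := by
          have := ht x
          rw [hx, map_zero] at this
          exact this.symm
        exact ⟨⟨x.1, h1⟩, Subtype.ext (hs _)⟩
      · rintro ⟨y, rfl⟩
        apply h.injective
        rw [ht, LinearMap.comp_apply, hs, map_zero]
        exact y.2
    · intro a
      obtain ⟨g, hg⟩ := hq (i a)
      refine ⟨⟨g, ?_⟩, h.injective ?_⟩
      · simp [hg, h.apply_apply]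
      · rw [ht]; exact hg

lemma isSES_prod_map_id (h : IsSES i p) (P : Type u) [AddCommGroup P] [Module R P] :
    IsSES (LinearMap.inl R B P ∘ₗ i) (p.prodMap (LinearMap.id : P →ₗ[R] P)) := by
  refine ⟨LinearMap.inl_injective.comp h.injective, ?_, ?_⟩
  · rintro ⟨b, x⟩
    constructor
    · intro hx
      obtain ⟨a, rfl⟩ := h.exists_lift (congrArg Prod.fst hx : p b = 0)
      exact ⟨a, Prod.ext rfl (congrArg Prod.snd hx : x = 0).symm⟩
    · rintro ⟨a, ha⟩
      rw [← ha]
      simp [h.apply_apply]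
  · rintro ⟨c, x⟩
    obtain ⟨b, rfl⟩ := h.surjective c
    exact ⟨(b, x), rfl⟩

lemma isSES_inl_snd (A P : Type u) [AddCommGroup A] [Module R A] [AddCommGroup P] [Module R P] :
    IsSES (LinearMap.inl R A P) (LinearMap.snd R A P) :=
  ⟨LinearMap.inl_injective, Function.Exact.inl_snd, LinearMap.snd_surjective⟩

lemma GRes.prod {n : ℕ} (h : GRes R n A) (P : Type u) [AddCommGroup P] [Module R P]
    [Module.Projective R P] : GRes R n (A × P) := by
  cases n with
  | zero => exact (isSES_inl_snd A P).gproj_middle h gproj_of_projective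
  | succ n =>
    obtain ⟨G, q, hG, hq, hK⟩ := h
    exact (isSES_prod_map_id (isSES_ker hq) P).gRes_succ
      ((isSES_inl_snd G P).gproj_middle hG gproj_of_projective) hK

/-- If `C` has a resolution of length `n + 1` by Gorenstein projective modules, then the kernel of
every surjection from a projective module onto `C` has one of length `n`. -/
lemma IsSES.gRes_of_succ {n : ℕ} (h : IsSES i p) [Module.Projective R B]
    (hC : GRes R (n + 1) C) : GRes R n A := by
  obtain ⟨G, q, hG, hq, hK⟩ := hC
  obtain ⟨f, hf⟩ := Module.projective_lifting_property q p hq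
  have hf' : ∀ b, q (f b) = p b := fun b => LinearMap.congr_fun hf b
  -- `A` is the kernel of the surjection `ker q × B → G`, `(k, b) ↦ k + f b`.
  obtain ⟨t, ht⟩ := (isSES_ker hq).exists_map_lift (-(f ∘ₗ i)) fun a => by
    simp [hf', h.apply_apply]
  refine IsSES.gRes_left (i := t.prod i) (p := (LinearMap.ker q).subtype.coprod f) ⟨?_, ?_, ?_⟩
    (GRes.prod hK B) hG
  · intro a a' haa
    exact h.injective (congrArg Prod.snd haa)
  · rintro ⟨k, b⟩
    constructor
    · intro hx
      have hx' : (k : G) + f b = 0 := hx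
      obtain ⟨a, rfl⟩ := h.exists_lift (b := b) (by
        have := congrArg q hx'
        rwa [map_add, LinearMap.mem_ker.1 k.2, zero_add, hf', map_zero] at this)
      refine ⟨a, Prod.ext (Subtype.ext ?_) rfl⟩
      exact (ht a).trans (neg_eq_of_add_eq_zero_left hx')
    · rintro ⟨a, ha⟩
      rw [← ha]
      change (LinearMap.ker q).subtype (t a) + f (i a) = 0
      simp [ht]
  · intro g
    obtain ⟨b, hb⟩ := h.surjective (q g)
    refine ⟨(⟨g - f b, by simp [hf', hb]⟩, b), ?_⟩
    simp

end GorensteinResolutions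

/-! ### Dual numbers as a Frobenius extension -/

section DualNumbers

variable {R : Type u} [CommRing R]

instance : Module.Free R R[ε] := inferInstanceAs (Module.Free R (R × R))

lemma eps_smul_eps_smul {N : Type u} [AddCommGroup N] [Module R[ε] N] (x : N) :
    (ε : R[ε]) • (ε : R[ε]) • x = 0 := by
  rw [smul_smul, DualNumber.eps_mul_eps, zero_smul]

variable {A B C N P Q : Type u} [AddCommGroup A] [Module R A] [Module R[ε] A] [IsScalarTower R R[ε] A]
  [AddCommGroup B] [Module R B] [Module R[ε] B] [IsScalarTower R R[ε] B]
  [AddCommGroup C] [Module R C] [Module R[ε] C] [IsScalarTower R R[ε] C]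
  [AddCommGroup N] [Module R N] [Module R[ε] N] [IsScalarTower R R[ε] N]
  [AddCommGroup P] [Module R P] [AddCommGroup Q] [Module R Q]

lemma smul_eq_fst_add_snd (s : R[ε]) (x : N) :
    s • x = s.fst • x + s.snd • (ε : R[ε]) • x := by
  have : s = s.fst • (1 : R[ε]) + s.snd • (ε : R[ε]) := by ext <;> simp
  conv_lhs => rw [this]
  rw [add_smul, smul_assoc, one_smul, smul_assoc]

/-- An `R`-linear map that commutes with `ε` is `R[ε]`-linear. -/
def linearMapOfEps (f : A →ₗ[R] B) (h : ∀ a, f ((ε : R[ε]) • a) = (ε : R[ε]) • f a) :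
    A →ₗ[R[ε]] B where
  toFun := f
  map_add' := map_add f
  map_smul' s a := by
    rw [smul_eq_fst_add_snd s a, map_add, map_smul, map_smul, h, RingHom.id_apply,
      ← smul_eq_fst_add_snd]

/-- The coordinate `1 ⊗ a + ε ⊗ b ↦ a` on the induced module `R[ε] ⊗ P`. -/
noncomputable def indFst : R[ε] ⊗[R] P →ₗ[R] P :=
  TensorProduct.lid R P ∘ₗ (TrivSqZeroExt.fstHom R R R).toLinearMap.rTensor P

/-- The coordinate `1 ⊗ a + ε ⊗ b ↦ b` on the induced module `R[ε] ⊗ P`. -/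
noncomputable def indSnd : R[ε] ⊗[R] P →ₗ[R] P :=
  TensorProduct.lid R P ∘ₗ (TrivSqZeroExt.sndHom R R).rTensor P

@[simp] lemma indFst_tmul (s : R[ε]) (x : P) : indFst (s ⊗ₜ[R] x) = s.fst • x := by
  simp [indFst]

@[simp] lemma indSnd_tmul (s : R[ε]) (x : P) : indSnd (s ⊗ₜ[R] x) = s.snd • x := by
  simp [indSnd]

lemma ind_eq (z : R[ε] ⊗[R] P) : z = 1 ⊗ₜ[R] indFst z + ε ⊗ₜ[R] indSnd z := by
  induction z with
  | zero => simp
  | tmul s x =>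
    have : s = s.fst • (1 : R[ε]) + s.snd • (ε : R[ε]) := by ext <;> simp
    rw [indFst_tmul, indSnd_tmul, TensorProduct.tmul_smul, TensorProduct.tmul_smul,
      TensorProduct.smul_tmul', TensorProduct.smul_tmul', ← TensorProduct.add_tmul, ← this]
  | add y z hy hz =>
    rw [map_add, map_add, TensorProduct.tmul_add, TensorProduct.tmul_add]
    nth_rw 1 [hy, hz]
    abel

lemma ind_ext {y z : R[ε] ⊗[R] P} (h₁ : indFst y = indFst z) (h₂ : indSnd y = indSnd z) :
    y = z := by
  rw [ind_eq y, ind_eq z, h₁, h₂]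

@[simp] lemma indFst_eps_smul (z : R[ε] ⊗[R] P) : indFst ((ε : R[ε]) • z) = 0 := by
  rw [ind_eq z, smul_add, TensorProduct.smul_tmul', TensorProduct.smul_tmul']
  simp

@[simp] lemma indSnd_eps_smul (z : R[ε] ⊗[R] P) : indSnd ((ε : R[ε]) • z) = indFst z := by
  conv_lhs => rw [ind_eq z, smul_add, TensorProduct.smul_tmul', TensorProduct.smul_tmul']
  simp

/-- `R[ε]` is a Frobenius extension of `R`: an `R`-linear map from an `R[ε]`-module `B` to `P`
corresponds to an `R[ε]`-linear map from `B` to `R[ε] ⊗ P`, of which it is the coordinate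
at `ε`. -/
noncomputable def coind (g : B →ₗ[R] P) : B →ₗ[R[ε]] R[ε] ⊗[R] P :=
  linearMapOfEps
    (TensorProduct.mk R R[ε] P 1 ∘ₗ g ∘ₗ (LinearMap.lsmul R[ε] B ε).restrictScalars R +
      TensorProduct.mk R R[ε] P ε ∘ₗ g)
    fun b => by
      refine ind_ext ?_ ?_ <;> simp [eps_smul_eps_smul]

@[simp] lemma indFst_coind (g : B →ₗ[R] P) (b : B) :
    indFst (coind g b) = g ((ε : R[ε]) • b) := by
  simp [coind, linearMapOfEps]

@[simp] lemma indSnd_coind (g : B →ₗ[R] P) (b : B) : indSnd (coind g b) = g b := by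
  simp [coind, linearMapOfEps]

/-- An `R[ε]`-linear map into an induced module is determined by its coordinate at `ε`. -/
lemma ind_hom_ext {X : Type u} [AddCommGroup X] [Module R[ε] X]
    {φ ψ : X →ₗ[R[ε]] R[ε] ⊗[R] P} (h : ∀ b, indSnd (φ b) = indSnd (ψ b)) :
    φ = ψ := by
  refine LinearMap.ext fun b => ind_ext ?_ (h b)
  rw [← indSnd_eps_smul, ← indSnd_eps_smul, ← map_smul, ← map_smul, h]

/-- The `R[ε]`-linear map `R[ε] ⊗ P → N` induced by an `R`-linear map `P → N`. -/
noncomputable def indLift (g : P →ₗ[R] N) : R[ε] ⊗[R] P →ₗ[R[ε]] N :=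
  linearMapOfEps (g ∘ₗ indFst + (LinearMap.lsmul R[ε] N ε).restrictScalars R ∘ₗ g ∘ₗ indSnd)
    fun z => by simp [eps_smul_eps_smul]

lemma indLift_apply (g : P →ₗ[R] N) (z : R[ε] ⊗[R] P) :
    indLift g z = g (indFst z) + (ε : R[ε]) • g (indSnd z) := rfl

lemma indLift_surjective : Function.Surjective (indLift (LinearMap.id : N →ₗ[R] N)) :=
  fun x => ⟨1 ⊗ₜ x, by simp [indLift_apply]⟩

variable (R) in
/-- Restriction of scalars along `R → R[ε]` preserves projectivity. -/
lemma projective_restrict [h : Module.Projective R[ε] N] : Module.Projective R N := by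
  have h' := h
  obtain ⟨s, hs⟩ := h
  let f : N →ₗ[R] (N →₀ R[ε]) := s.restrictScalars R
  exact Module.Projective.of_split f
    ((Finsupp.linearCombination R[ε] id).restrictScalars R) (LinearMap.ext hs)

/-- Relative injectivity of projective `R[ε]`-modules: an `R[ε]`-linear map to a projective module
extends along `j` if all `R`-linear maps to projective `R`-modules do. -/
lemma exists_extend_of_restrict {X : Type u} [AddCommGroup X] [Module R[ε] X] (j : A →ₗ[R[ε]] B)
    (h : ∀ (Q : Type u) [AddCommGroup Q] [Module R Q] [Module.Projective R Q] (f : A →ₗ[R] Q),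
      ∃ g : B →ₗ[R] Q, ∀ a, g (j a) = f a)
    [Module.Projective R[ε] X] (f : A →ₗ[R[ε]] X) : ∃ g : B →ₗ[R[ε]] X, ∀ a, g (j a) = f a := by
  let : Module R X := Module.compHom X (algebraMap R R[ε])
  have : IsScalarTower R R[ε] X := IsScalarTower.of_algebraMap_smul fun _ _ => rfl
  have := projective_restrict R (N := X)
  obtain ⟨s, hs⟩ := Module.projective_lifting_property (indLift (LinearMap.id : X →ₗ[R] X))
    LinearMap.id indLift_surjective
  obtain ⟨g, hg⟩ := h X (indSnd ∘ₗ (s ∘ₗ f).restrictScalars R)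
  have : coind g ∘ₗ j = s ∘ₗ f := ind_hom_ext fun a => by simp [hg]
  refine ⟨indLift LinearMap.id ∘ₗ coind g, fun a => ?_⟩
  rw [LinearMap.comp_apply, ← LinearMap.comp_apply (coind g) j, this]
  exact LinearMap.congr_fun hs (f a)

lemma IsSES.restrict {i : A →ₗ[R[ε]] B} {p : B →ₗ[R[ε]] C} (h : IsSES i p) :
    IsSES (i.restrictScalars R) (p.restrictScalars R) :=
  ⟨h.injective, h.exact, h.surjective⟩

variable (R) in
/-- Every module over `R[ε]` is a quotient of a projective module `P`. The `R`-module structure of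
`P` obtained by restriction of scalars is part of the data. -/
lemma exists_projective_surjective_dual (M : Type u) [AddCommGroup M] [Module R[ε] M] :
    ∃ (P : Type u) (_ : AddCommGroup P) (_ : Module R P) (_ : Module R[ε] P)
      (_ : IsScalarTower R R[ε] P) (p : P →ₗ[R[ε]] M),
      Module.Projective R[ε] P ∧ Function.Surjective p :=
  ⟨M →₀ R[ε], inferInstance, inferInstance, inferInstance, inferInstance,
    Finsupp.linearCombination R[ε] id, inferInstance,
    Finsupp.linearCombination_id_surjective R[ε] M⟩

end DualNumbers

/-! ### Projective dimension over the dual numbers -/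

section ProjectiveDimensionDualNumbers

variable {R : Type u} [CommRing R]

variable {N : Type u} [AddCommGroup N] [Module R N] [Module R[ε] N] [IsScalarTower R R[ε] N]
  {M : Type u} [AddCommGroup M] [Module R M]

lemma pdLT_restrict {n : ℕ} (h : PdLT R[ε] N n) : PdLT R N n := by
  induction n using Nat.twoStepInduction generalizing N with
  | zero => exact pdLT_zero_iff.2 (pdLT_zero_iff.1 h)
  | one =>
    have := pdLT_one_iff.1 h
    exact pdLT_one_iff.2 (projective_restrict R)
  | more n _ ih =>
    obtain ⟨P, _, _, _, _, p, hP, hp⟩ := exists_projective_surjective_dual R N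
    have hs := isSES_ker hp
    have := projective_restrict R (N := P)
    exact (hs.restrict.pdLT_succ_iff n).2 (ih ((hs.pdLT_succ_iff n).1 h))

/-- A module over `R[ε]` of finite projective dimension that is projective over `R` is
projective. -/
lemma projective_of_pdLT {n : ℕ} (h : PdLT R[ε] N (n + 1)) [Module.Projective R N] :
    Module.Projective R[ε] N := by
  induction n generalizing N with
  | zero => exact pdLT_one_iff.1 h
  | succ n ih =>
    obtain ⟨P, _, _, _, _, p, hP, hp⟩ := exists_projective_surjective_dual R N
    have hs := isSES_ker hp
    have := projective_restrict R (N := P)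
    have : Module.Projective R (LinearMap.ker p) := hs.restrict.projective_left
    have := ih ((hs.pdLT_succ_iff n).1 h)
    -- The sequence splits over `R`, so it splits over `R[ε]` by relative injectivity.
    obtain ⟨r, hr⟩ := hs.restrict.exists_retraction_of_projective (R := R)
    obtain ⟨g, hg⟩ := exists_extend_of_restrict (LinearMap.ker p).subtype
      (fun Q _ _ _ f => ⟨f ∘ₗ r, fun a => congrArg f (hr a)⟩) LinearMap.id
    exact hs.projective_of_retraction g hg

/-- Modules over `R[ε]` of finite projective dimension have the same projective dimension
over `R`. -/
lemma pdLT_of_restrict {n k : ℕ} (hk : PdLT R[ε] N k) (h : PdLT R N n) : PdLT R[ε] N n := by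
  induction n using Nat.twoStepInduction generalizing N k with
  | zero => exact pdLT_zero_iff.2 (pdLT_zero_iff.1 h)
  | one =>
    have := pdLT_one_iff.1 h
    have : PdLT R[ε] N (k + 1) := hasProjectiveDimensionLT_of_ge _ k _ (by omega)
    exact pdLT_one_iff.2 (projective_of_pdLT this)
  | more n _ ih =>
    obtain ⟨P, _, _, _, _, p, hP, hp⟩ := exists_projective_surjective_dual R N
    have hs := isSES_ker hp
    have := projective_restrict R (N := P)
    have hk' : PdLT R[ε] N (k + 2) := hasProjectiveDimensionLT_of_ge _ k _ (by omega)
    exact (hs.pdLT_succ_iff n).2 (ih ((hs.pdLT_succ_iff k).1 hk')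
      ((hs.restrict.pdLT_succ_iff n).1 h))

lemma isSES_baseChange {A B C : Type u} [AddCommGroup A] [Module R A] [AddCommGroup B]
    [Module R B] [AddCommGroup C] [Module R C] {i : A →ₗ[R] B} {p : B →ₗ[R] C} (h : IsSES i p) :
    IsSES (i.baseChange R[ε]) (p.baseChange R[ε]) :=
  ⟨Module.Flat.lTensor_preserves_injective_linearMap i h.injective,
    Module.Flat.lTensor_exact R[ε] h.exact, LinearMap.lTensor_surjective R[ε] h.surjective⟩

lemma pdLT_baseChange {n : ℕ} (h : PdLT R M n) : PdLT R[ε] (R[ε] ⊗[R] M) n := by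
  induction n using Nat.twoStepInduction generalizing M with
  | zero =>
    have := pdLT_zero_iff.1 h
    exact pdLT_zero_iff.2 inferInstance
  | one =>
    have := pdLT_one_iff.1 h
    exact pdLT_one_iff.2 inferInstance
  | more n _ ih =>
    obtain ⟨P, p, hP, hp⟩ := exists_projective_surjective R M
    have hs := isSES_ker hp
    exact ((isSES_baseChange hs).pdLT_succ_iff n).2 (ih ((hs.pdLT_succ_iff n).1 h))

/-- `M` is a direct summand of `R[ε] ⊗ M` over `R`. -/
lemma pdLT_of_baseChange {n : ℕ} (h : PdLT R[ε] (R[ε] ⊗[R] M) n) : PdLT R M n :=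
  pdLT_of_retract (TensorProduct.mk R R[ε] M 1) indFst (fun x => by simp) (pdLT_restrict h)

end ProjectiveDimensionDualNumbers

/-! ### Gorenstein projective dimension over the dual numbers -/

section GorensteinDualNumbers

variable {R : Type u} [CommRing R]

variable {N : Type u} [AddCommGroup N] [Module R N] [Module R[ε] N] [IsScalarTower R R[ε] N]

/-- Restriction of scalars along `R → R[ε]` preserves complete projective resolutions, because
`Hom_R(-, Q)` and `Hom_{R[ε]}(-, R[ε] ⊗ Q)` agree on `R[ε]`-modules. -/
lemma gproj_restrict (h : GProj R[ε] N) : GProj R N := by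
  obtain ⟨P, d, hP, ⟨e⟩⟩ := h
  let : ∀ j, Module R (P j) := fun j => Module.compHom (P j) (algebraMap R R[ε])
  have : ∀ j, IsScalarTower R R[ε] (P j) := fun j => IsScalarTower.of_algebraMap_smul fun _ _ => rfl
  refine ⟨fun j => ModuleCat.of R (P j), fun j => (d j).restrictScalars R, ⟨fun j => ?_, hP.exact,
    fun Q hQ j f => ?_⟩, ⟨?_⟩⟩
  · have := hP.projective j
    exact projective_restrict R (N := P j)
  · let f' : P (j + 1) →ₗ[R] Q := f
    constructor
    · intro hf
      have hf' : ∀ b, f' (d j b) = 0 := fun b => LinearMap.congr_fun hf b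
      obtain ⟨g, hg⟩ := (hP.hom_exact (ModuleCat.of R[ε] (R[ε] ⊗[R] Q))
        (inferInstanceAs (Module.Projective R[ε] (R[ε] ⊗[R] Q))) j (coind f')).1
        (ind_hom_ext fun b => by simp [hf'])
      refine ⟨indSnd ∘ₗ g.restrictScalars R, LinearMap.ext fun b => ?_⟩
      exact (congrArg indSnd (LinearMap.congr_fun hg b)).trans (indSnd_coind f' b)
    · rintro ⟨g, rfl⟩
      refine LinearMap.ext fun b => ?_
      exact (congrArg g ((hP.exact j).apply_apply_eq_zero b)).trans (map_zero g)
  · exact e.restrictScalars R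

lemma gRes_restrict {n : ℕ} (h : GRes R[ε] n N) : GRes R n N := by
  induction n generalizing N with
  | zero => exact gproj_restrict h
  | succ n ih =>
    obtain ⟨G, p, hG, hp, hK⟩ := h
    let : Module R G := Module.compHom G (algebraMap R R[ε])
    have : IsScalarTower R R[ε] G := IsScalarTower.of_algebraMap_smul fun _ _ => rfl
    exact (isSES_ker hp).restrict.gRes_succ (gproj_restrict hG) (ih hK)

/-- An `R`-linear embedding `N → P` induces an `R[ε]`-linear embedding `N → R[ε] ⊗ P`, whose
cokernel is over `R` an extension of the cokernel of `N → P` by `P`. -/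
lemma exists_coind_cokernel {P G : Type u} [AddCommGroup P] [Module R P] [AddCommGroup G]
    [Module R G] {i : N →ₗ[R] P} {p : P →ₗ[R] G} (h : IsSES i p) :
    Function.Injective (coind i) ∧
      ∃ (j : P →ₗ[R] (R[ε] ⊗[R] P) ⧸ LinearMap.range (coind i))
        (q : ((R[ε] ⊗[R] P) ⧸ LinearMap.range (coind i)) →ₗ[R] G), IsSES j q := by
  have hinj : Function.Injective (coind i) := fun x y hxy =>
    h.injective (by rw [← indSnd_coind, hxy, indSnd_coind])
  have hs := (isSES_mkQ hinj).restrict (R := R)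
  obtain ⟨q, hq⟩ := exists_factor hs.surjective (p ∘ₗ indSnd) fun z hz => by
    obtain ⟨x, rfl⟩ := hs.exists_lift hz
    simp [h.apply_apply]
  let m : R[ε] ⊗[R] P →ₗ[R] (R[ε] ⊗[R] P) ⧸ LinearMap.range (coind i) :=
    (LinearMap.range (coind i)).mkQ.restrictScalars R
  refine ⟨hinj, m ∘ₗ TensorProduct.mk R R[ε] P 1, q, ?_, ?_, ?_⟩
  · refine (injective_iff_map_eq_zero _).2 fun x hx => ?_
    obtain ⟨y, hy⟩ := hs.exists_lift hx
    replace hy : coind i y = 1 ⊗ₜ[R] x := hy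
    have h1 : i y = 0 := by
      have := congrArg indSnd hy
      simpa using this
    have h2 : y = 0 := h.injective (by rw [h1, map_zero])
    have := congrArg indFst hy
    simpa [h2] using this.symm
  · intro z'
    obtain ⟨z, rfl⟩ := hs.surjective z'
    constructor
    · intro hz
      rw [hq] at hz
      obtain ⟨x, hx⟩ := h.exists_lift hz
      refine ⟨indFst (z - coind i x), ?_⟩
      have h1 : (1 : R[ε]) ⊗ₜ[R] indFst (z - coind i x) = z - coind i x := by
        conv_rhs => rw [ind_eq (z - coind i x)]
        rw [map_sub indSnd, indSnd_coind, hx, sub_self, TensorProduct.tmul_zero, add_zero]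
      have h2 : m (coind i x) = 0 := hs.apply_apply x
      rw [LinearMap.comp_apply, TensorProduct.mk_apply, h1, map_sub, h2, sub_zero]
    · rintro ⟨x, hx⟩
      rw [← hx]
      exact (hq _).trans (by simp)
  · intro g
    obtain ⟨x, rfl⟩ := h.surjective g
    exact ⟨m (ε ⊗ₜ x), (hq _).trans (by simp)⟩

/-- The `R[ε]`-modules that are Gorenstein projective over `R` after restriction of scalars. -/
def RestrictGProj (M : ModuleCat.{u} R[ε]) : Prop :=
  let : Module R M := Module.compHom M (algebraMap R R[ε])
  GProj R M

lemma restrictGProj_iff {N : Type u} [AddCommGroup N] [inst : Module R N] [Module R[ε] N]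
    [IsScalarTower R R[ε] N] : RestrictGProj (ModuleCat.of R[ε] N) ↔ GProj R N := by
  have h : inst = Module.compHom N (algebraMap R R[ε]) :=
    Module.ext' _ _ fun r x => (algebraMap_smul R[ε] r x).symm
  subst h
  rfl

lemma gproj_of_restrict (h : GProj R N) : GProj R[ε] N := by
  refine isGorensteinProjective_of_right_class (R := R[ε]) RestrictGProj ?_ ?_ _
    (restrictGProj_iff.2 h)
  · intro M hM
    let : Module R M := Module.compHom M (algebraMap R R[ε])
    have : IsScalarTower R R[ε] M := IsScalarTower.of_algebraMap_smul fun _ _ => rfl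
    obtain ⟨P, G, i, p, hG, hP, hs⟩ := GProj.exists_right hM
    obtain ⟨hi, j, q, hjq⟩ := exists_coind_cokernel hs
    refine ⟨ModuleCat.of R[ε] (R[ε] ⊗[R] P),
      ModuleCat.of R[ε] ((R[ε] ⊗[R] P) ⧸ LinearMap.range (coind i)), coind i, _,
      restrictGProj_iff.2 (hjq.gproj_middle gproj_of_projective hG),
      inferInstanceAs (Module.Projective R[ε] (R[ε] ⊗[R] P)), isSES_mkQ hi⟩
  · refine projOrth_of_syzygies (R := R[ε]) RestrictGProj fun M hM => ?_
    let : Module R M := Module.compHom M (algebraMap R R[ε])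
    have : IsScalarTower R R[ε] M := IsScalarTower.of_algebraMap_smul fun _ _ => rfl
    obtain ⟨P, _, _, _, _, p, hP, hp⟩ := exists_projective_surjective_dual R M
    have hs := isSES_ker hp
    have := projective_restrict R (N := P)
    refine ⟨ModuleCat.of R[ε] (LinearMap.ker p), ModuleCat.of R[ε] P, _, p,
      restrictGProj_iff.2 (GProj.ker_of_projective hM (hs.restrict (R := R))), hP, hs,
      fun Q hQ f => ?_⟩
    exact exists_extend_of_restrict (LinearMap.ker p).subtype
      (fun Q _ _ _ f => (GProj.projOrth hM).exists_extend (hs.restrict (R := R)) f)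
      f

lemma gRes_of_restrict {n : ℕ} (h : GRes R n N) : GRes R[ε] n N := by
  induction n generalizing N with
  | zero => exact gproj_of_restrict h
  | succ n ih =>
    obtain ⟨P, _, _, _, _, p, hP, hp⟩ := exists_projective_surjective_dual R N
    have hs := isSES_ker hp
    have := projective_restrict R (N := P)
    exact hs.gRes_succ gproj_of_projective (ih (hs.restrict.gRes_of_succ h))

variable (R) in
/-- An `R[ε]`-module has the same Gorenstein projective dimension over `R[ε]` and over `R`. -/
lemma gpd_restrict (N : Type u) [AddCommGroup N] [Module R N] [Module R[ε] N]
    [IsScalarTower R R[ε] N] : Gpd (ModuleCat.of R[ε] N) = Gpd (ModuleCat.of R N) :=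
  iInf_congr fun _ => iInf_congr_Prop ⟨gRes_restrict, gRes_of_restrict⟩ fun _ => rfl

variable (R) in
/-- Every `R`-module is an `R[ε]`-module on which `ε` acts as zero. -/
lemma exists_module_dual (M : Type u) [AddCommGroup M] [Module R M] :
    ∃ _ : Module R[ε] M, IsScalarTower R R[ε] M := by
  let : Module R[ε] M := Module.compHom M (TrivSqZeroExt.fstHom R R R).toRingHom
  refine ⟨inferInstance, IsScalarTower.of_algebraMap_smul fun r x => ?_⟩
  change (TrivSqZeroExt.fstHom R R R (algebraMap R R[ε] r)) • x = r • x
  simp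

variable (R) in
lemma ggldim_dual : Ggldim R[ε] = Ggldim R := by
  refine le_antisymm (iSup_le fun N => ?_) (iSup_le fun M => ?_)
  · let : Module R N := Module.compHom N (algebraMap R R[ε])
    have : IsScalarTower R R[ε] N := IsScalarTower.of_algebraMap_smul fun _ _ => rfl
    exact (gpd_restrict R N).le.trans (le_iSup Gpd (ModuleCat.of R N))
  · obtain ⟨_, _⟩ := exists_module_dual R M
    exact (gpd_restrict R M).ge.trans (le_iSup Gpd (ModuleCat.of R[ε] M))

end GorensteinDualNumbers

/-! ### Finitistic and global dimension -/

section FinitisticDimension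

lemma projectiveDimension_le_of_pdLT {R S : Type u} [CommRing R] [CommRing S]
    {X : ModuleCat.{u} R} {Y : ModuleCat.{u} S}
    (h : ∀ n, HasProjectiveDimensionLT Y n → HasProjectiveDimensionLT X n) :
    projectiveDimension X ≤ projectiveDimension Y :=
  sInf_le_sInf fun _ hn i hi => h i (hn i hi)

lemma exists_pdLT {R : Type u} [CommRing R] {X : ModuleCat.{u} R}
    (h : projectiveDimension X < ⊤) : ∃ n, PdLT R X n := by
  obtain ⟨n, hn⟩ := (projectiveDimension_ne_top_iff X).1 h.ne
  exact ⟨n + 1, hn⟩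

variable (R : Type u) [CommRing R]

lemma fpd_dual : FPD R[ε] = FPD R := by
  refine le_antisymm (iSup₂_le fun N hN => ?_) (iSup₂_le fun M hM => ?_)
  · let : Module R N := Module.compHom N (algebraMap R R[ε])
    have : IsScalarTower R R[ε] N := IsScalarTower.of_algebraMap_smul fun _ _ => rfl
    obtain ⟨k, hk⟩ := exists_pdLT hN
    have h1 : projectiveDimension N ≤ projectiveDimension (ModuleCat.of R N) :=
      projectiveDimension_le_of_pdLT fun n hn => pdLT_of_restrict hk hn
    have h2 : projectiveDimension (ModuleCat.of R N) ≤ projectiveDimension N :=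
      projectiveDimension_le_of_pdLT fun n hn => pdLT_restrict (N := N) hn
    exact h1.trans (le_iSup₂_of_le (ModuleCat.of R N) (h2.trans_lt hN) le_rfl)
  · have h1 : projectiveDimension M ≤ projectiveDimension (ModuleCat.of R[ε] (R[ε] ⊗[R] M)) :=
      projectiveDimension_le_of_pdLT fun n hn => pdLT_of_baseChange hn
    have h2 : projectiveDimension (ModuleCat.of R[ε] (R[ε] ⊗[R] M)) ≤ projectiveDimension M :=
      projectiveDimension_le_of_pdLT fun n hn => pdLT_baseChange (M := M) hn
    exact h1.trans (le_iSup₂_of_le (ModuleCat.of R[ε] (R[ε] ⊗[R] M)) (h2.trans_lt hM) le_rfl)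

lemma gldim_dual [Nontrivial R] : gldim R[ε] = ⊤ := by
  let : Module R[ε] R := Module.compHom R (TrivSqZeroExt.fstHom R R R).toRingHom
  have hsmul : ∀ (s : R[ε]) (r : R), s • r = s.fst * r := fun _ _ => rfl
  have : IsScalarTower R R[ε] R := IsScalarTower.of_algebraMap_smul fun r x => by
    rw [hsmul, TrivSqZeroExt.algebraMap_eq_inl, TrivSqZeroExt.fst_inl, smul_eq_mul]
  by_contra hne
  have h : projectiveDimension (ModuleCat.of R[ε] R) < ⊤ :=
    (le_iSup (fun M : ModuleCat.{u} R[ε] => projectiveDimension M) _).trans_lt (Ne.lt_top hne)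
  obtain ⟨k, hk⟩ := exists_pdLT h
  have hk' : PdLT R[ε] R (k + 1) := hasProjectiveDimensionLT_of_ge _ k _ (by omega)
  have := projective_of_pdLT hk'
  -- A section of `R[ε] → R` sends `1` to an element `1 + b ε`, which `ε` does not annihilate.
  let p : R[ε] →ₗ[R[ε]] R := LinearMap.toSpanSingleton R[ε] R 1
  obtain ⟨s, hs⟩ := Module.projective_lifting_property p LinearMap.id fun r =>
    ⟨algebraMap R R[ε] r, by
      change algebraMap R R[ε] r • (1 : R) = r
      rw [hsmul, TrivSqZeroExt.algebraMap_eq_inl, TrivSqZeroExt.fst_inl, mul_one]⟩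
  have h1 : (s 1).fst = 1 := by
    have h1 : s 1 • (1 : R) = 1 := LinearMap.congr_fun hs 1
    rwa [hsmul, mul_one] at h1
  have h2 : (ε : R[ε]) * s 1 = 0 := by
    rw [← smul_eq_mul, ← map_smul, hsmul, DualNumber.fst_eps, zero_mul, map_zero]
  have h3 := congrArg TrivSqZeroExt.snd h2
  rw [DualNumber.snd_mul, h1] at h3
  simp at h3

end FinitisticDimension

/-! ### Flat modules and cotorsion dimension -/

section CotorsionDimension

variable {R : Type u} [CommRing R]

lemma IsSES.flat_left {A B C : Type u} [AddCommGroup A] [Module R A] [AddCommGroup B]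
    [Module R B] [AddCommGroup C] [Module R C] {i : A →ₗ[R] B} {p : B →ₗ[R] C} (h : IsSES i p)
    [Module.Flat R B] [Module.Flat R C] : Module.Flat R A := by
  refine Module.Flat.iff_lTensor_preserves_injective_linearMap'.{u}.2 fun X Y _ _ _ _ f hf => ?_
  have h1 : Function.Injective (f.lTensor B ∘ₗ i.rTensor X) := by
    refine (Module.Flat.lTensor_preserves_injective_linearMap f hf).comp ?_
    rw [← LinearMap.lTensor_inj_iff_rTensor_inj]
    exact LinearMap.lTensor_injective_of_exact_of_flat p h.surjective i h.injective h.exact X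
  rw [LinearMap.lTensor_comp_rTensor, ← LinearMap.rTensor_comp_lTensor] at h1
  exact Function.Injective.of_comp h1

/-- The cotorsion dimension is at most `n` exactly when flat modules have projective dimension at
most `n`. -/
lemma cotD_le_iff (n : ℕ) : cotD R ≤ n ↔
    ∀ (F : Type u) [AddCommGroup F] [Module R F] [Module.Flat R F], PdLT R F (n + 1) := by
  constructor
  · intro h F _ _ hF
    refine (hasProjectiveDimensionLT_iff _ _).2 fun m hm M e => ?_
    have hM : cotorsionDim M < (n + 1 : ℕ) :=
      ((le_iSup cotorsionDim M).trans h).trans_lt (by exact_mod_cast n.lt_succ_self)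
    obtain ⟨k, hk⟩ := iInf_lt_iff.1 hM
    obtain ⟨hk, hkn⟩ := iInf_lt_iff.1 hk
    have hkn : k < n + 1 := by exact_mod_cast hkn
    -- Syzygies of flat modules are flat, so the vanishing persists in all degrees above `k`.
    have key : ∀ (l : ℕ) (F : ModuleCat.{u} R), Module.Flat R F →
        Subsingleton (Abelian.Ext.{u} F M (k + l + 1)) := by
      intro l
      induction l with
      | zero => exact hk
      | succ l ih =>
        intro F hF
        obtain ⟨P, p, hP, hp⟩ := exists_projective_surjective R F
        have hs := isSES_ker hp
        have := hs.flat_left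
        exact hs.subsingleton_ext_right M _ (ih (ModuleCat.of R (LinearMap.ker p)) this)
          (projective_subsingleton_ext M (k + l + 1))
    obtain ⟨l, rfl⟩ : ∃ l, m = k + l + 1 := ⟨m - k - 1, by omega⟩
    exact (key l (ModuleCat.of R F) hF).elim _ _
  · intro h
    refine iSup_le fun M => iInf₂_le n fun F hF => ?_
    have : PdLT R F (n + 1) := @h F _ _ hF
    exact HasProjectiveDimensionLT.subsingleton (ModuleCat.of R F) (n + 1) (n + 1) le_rfl M

variable {K : Type u} [AddCommGroup K] [Module R K] [Module R[ε] K] [IsScalarTower R R[ε] K]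

variable (R K) in
/-- The submodule `ε K` of an `R[ε]`-module `K`, as an `R`-module. -/
def epsRange : Submodule R K :=
  LinearMap.range ((LinearMap.lsmul R[ε] K ε).restrictScalars R)

variable (R K) in
/-- Multiplication by `ε`, as a map onto its image. -/
def epsMap : K →ₗ[R] epsRange R K :=
  ((LinearMap.lsmul R[ε] K ε).restrictScalars R).rangeRestrict

lemma coe_epsMap (x : K) : (epsMap R K x : K) = (ε : R[ε]) • x := rfl

lemma eps_smul_epsRange (x : epsRange R K) : (ε : R[ε]) • (x : K) = 0 := by
  obtain ⟨_, y, rfl⟩ := x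
  exact eps_smul_eps_smul y

/-- On a flat `R[ε]`-module the kernel of `ε` equals its image. -/
lemma isSES_epsRange [Module.Flat R[ε] K] : IsSES (epsRange R K).subtype (epsMap R K) := by
  refine ⟨Subtype.val_injective, fun x => ⟨fun hx => ?_, ?_⟩, LinearMap.surjective_rangeRestrict _⟩
  · have hx' : ∑ i : Fin 1, (fun _ => (ε : R[ε])) i • (fun _ => x) i = 0 := by
      simpa [coe_epsMap] using congrArg Subtype.val hx
    obtain ⟨k, a, y, hy, ha⟩ := Module.Flat.isTrivialRelation_of_sum_smul_eq_zero hx'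
    refine ⟨⟨x, ∑ j, (a 0 j).snd • y j, ?_⟩, rfl⟩
    have h0 : ∀ j, (a 0 j).fst = 0 := fun j => by
      have := congrArg TrivSqZeroExt.snd (ha j)
      simpa [DualNumber.snd_mul] using this
    refine Eq.trans ?_ (hy 0).symm
    rw [map_sum]
    refine Finset.sum_congr rfl fun j _ => ?_
    rw [smul_eq_fst_add_snd (a 0 j) (y j), h0, zero_smul, zero_add, map_smul]
    rfl
  · rintro ⟨y, rfl⟩
    exact Subtype.ext (eps_smul_epsRange y)

/-- If `K` is flat over `R[ε]`, then `ε K`, which is isomorphic to `K ⧸ ε K`, is flat over `R`: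
a relation in `ε K` with coefficients `r` is a relation in `K` with coefficients `r ε`. -/
lemma flat_epsRange [Module.Flat R[ε] K] : Module.Flat R (epsRange R K) := by
  refine Module.Flat.of_forall_isTrivialRelation fun {l f x} h => ?_
  choose z hz using fun i => (isSES_epsRange (R := R) (K := K)).surjective (x i)
  have h' : ∑ i, (f i • (ε : R[ε])) • z i = 0 := by
    have := congrArg Subtype.val h
    rw [AddSubmonoidClass.coe_finsetSum] at this
    rw [← this.trans (ZeroMemClass.coe_zero _)]
    refine Finset.sum_congr rfl fun i _ => ?_
    rw [← hz, Submodule.coe_smul, coe_epsMap, smul_assoc]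
  obtain ⟨k, a, y, hy, ha⟩ := Module.Flat.isTrivialRelation_of_sum_smul_eq_zero h'
  refine ⟨k, fun i j => (a i j).fst, fun j => epsMap R K (y j), fun i => ?_, fun j => ?_⟩
  · rw [← hz, hy, map_sum]
    refine Finset.sum_congr rfl fun j _ => Subtype.ext ?_
    rw [Submodule.coe_smul, coe_epsMap, coe_epsMap, smul_eq_fst_add_snd (a i j) (y j), smul_add,
      smul_comm, smul_comm _ (a i j).snd, eps_smul_eps_smul, smul_zero, add_zero]
  · have := congrArg TrivSqZeroExt.snd (ha j)
    rw [TrivSqZeroExt.snd_sum] at this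
    simpa [DualNumber.snd_mul] using this

/-- A module isomorphic to its own syzygy is projective as soon as its projective dimension is
finite. -/
lemma IsSES.projective_of_periodic {G B : Type u} [AddCommGroup G] [Module R G] [AddCommGroup B]
    [Module R B] {i : G →ₗ[R] B} {p : B →ₗ[R] G} (h : IsSES i p) [Module.Projective R B] {n : ℕ}
    (hG : PdLT R G (n + 1)) : Module.Projective R G := by
  induction n with
  | zero => exact pdLT_one_iff.1 hG
  | succ n ih => exact ih ((h.pdLT_succ_iff n).1 hG)

/-- If `K` is flat over `R[ε]` and `ε K` is projective over `R`, then `K` is isomorphic to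
`R[ε] ⊗ ε K`. -/
lemma projective_of_epsRange [Module.Flat R[ε] K] [Module.Projective R (epsRange R K)] :
    Module.Projective R[ε] K := by
  have h := isSES_epsRange (R := R) (K := K)
  obtain ⟨s, hs⟩ := Module.projective_lifting_property (epsMap R K) LinearMap.id h.surjective
  have hs' : ∀ g, (ε : R[ε]) • s g = (g : K) := fun g =>
    congrArg Subtype.val (LinearMap.congr_fun hs g)
  have hl : ∀ z, indLift s z = s (indFst z) + indSnd z := fun z => by
    rw [indLift_apply, hs']
  refine Module.Projective.of_equiv (LinearEquiv.ofBijective (indLift s)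
    ⟨(injective_iff_map_eq_zero _).2 fun z hz => ?_, fun x => ?_⟩)
  · rw [hl] at hz
    have h1 : indFst z = 0 := Subtype.ext (by
      have := congrArg ((ε : R[ε]) • ·) hz
      simpa [smul_add, hs', eps_smul_epsRange] using this)
    rw [h1, map_zero, zero_add] at hz
    exact ind_ext (by rw [h1, map_zero]) (by rw [map_zero]; exact Subtype.ext hz)
  · obtain ⟨y, hy⟩ := h.exists_lift (b := x - s (epsMap R K x)) (Subtype.ext (by
      rw [coe_epsMap, smul_sub, hs', coe_epsMap, sub_self]; rfl))
    refine ⟨1 ⊗ₜ epsMap R K x + ε ⊗ₜ y, ?_⟩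
    rw [hl]
    have hy' : (y : K) = x - s (epsMap R K x) := hy
    simp [hy']

/-- If flat `R`-modules have bounded projective dimension, then restriction to `R` does not lower
the projective dimension of a flat `R[ε]`-module. -/
lemma pdLT_of_flat {k n : ℕ}
    (hk : ∀ (F : Type u) [AddCommGroup F] [Module R F] [Module.Flat R F], PdLT R F (k + 1))
    [Module.Flat R[ε] K] (h : PdLT R K (n + 1)) : PdLT R[ε] K (n + 1) := by
  induction n generalizing K with
  | zero =>
    have := pdLT_one_iff.1 h
    have := flat_epsRange (R := R) (K := K)
    have := isSES_epsRange.projective_of_periodic (hk (epsRange R K))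
    exact pdLT_one_iff.2 (projective_of_epsRange (R := R))
  | succ n ih =>
    obtain ⟨P, _, _, _, _, p, hP, hp⟩ := exists_projective_surjective_dual R K
    have hs := isSES_ker hp
    have := projective_restrict R (N := P)
    have := hs.flat_left
    exact (hs.pdLT_succ_iff n).2 (ih ((hs.restrict.pdLT_succ_iff n).1 h))

variable (R) in
lemma cotD_dual : cotD R[ε] = cotD R := by
  have key : ∀ n : ℕ, cotD R[ε] ≤ n ↔ cotD R ≤ n := fun n => by
    rw [cotD_le_iff, cotD_le_iff]
    constructor
    · intro h F _ _ _
      exact pdLT_of_baseChange (h (R[ε] ⊗[R] F))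
    · intro h F _ _ _
      let : Module R F := Module.compHom F (algebraMap R R[ε])
      have : IsScalarTower R R[ε] F := IsScalarTower.of_algebraMap_smul fun _ _ => rfl
      have := Module.Flat.trans R R[ε] F
      exact pdLT_of_flat h (h F)
  refine le_antisymm ?_ ?_
  · cases h : cotD R with
    | top => exact le_top
    | coe n => exact (key n).2 h.le
  · cases h : cotD R[ε] with
    | top => exact le_top
    | coe n => exact (key n).1 h.le

end CotorsionDimension

end HomDim

theorem proposition2p6 (R : Type u) [CommRing R] :
    HomDim.FPD (TrivSqZeroExt R R) = HomDim.FPD R ∧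
    HomDim.cotD (TrivSqZeroExt R R) = HomDim.cotD R ∧
    (Nontrivial R → HomDim.gldim (TrivSqZeroExt R R) = ⊤) ∧
    (HomDim.IsCoherentRing R → HomDim.Ggldim (TrivSqZeroExt R R) = HomDim.Ggldim R) :=
  ⟨HomDim.fpd_dual R, HomDim.cotD_dual R, fun _ => HomDim.gldim_dual R,
    fun _ => HomDim.ggldim_dual R⟩
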